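/- **Setting.** Let $n,p\ge 0$ and $k\ge 1$ be integers and let $\Omega\subseteq\mathbb R^n$. Let $\square^n=[0,1]^n$. A $p$-face $\tau$ of $\square^n$ is obtained by letting $p$ coordinates $x_{i_1},\dots,x_{i_p}$ ($i_1<\dots<i_p$) vary in $[0,1]$ and fixing each other coordinate $x_i$ at a value $y_i\in\{0,1\}$. For a multi-index $\mathbf m=(m_1,\dots,m_n)$ with $0\le m_i\le k-1$, the corresponding $k$th order small $p$-cube of $\square^n$ is $\frac1k(\mathbf m+\tau)$, and the corresponding $k$th order cubical $p$-form is $$\Big(\prod_{i=1}^n x_i^{m_i}(1-x_i)^{k-1-m_i}\Big)\Big(\prod_{i\notin\{i_1,\dots,i_p\}}x_i^{y_i}(1-x_i)^{1-y_i}\Big)\,dx_{i_1}\wedge\dots\wedge dx_{i_p}.$$ A *cubical mesh* $K$ in $\Omega$ is a mesh whose $n$-cells $\sigma\subseteq\Omega$ are parallelotopes $\sigma=\phi_\sigma(\square^n)$, with $\phi_\sigma$ an affine bijection, such that any two $n$-cells that meet do so in a common face; its other cells are the faces of its $n$-cells. The $k$th order small $p$-cubes of $\sigma$ are the images under $\phi_\sigma$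 of those of $\square^n$, and $Q_k^p(\sigma)$ is the span of the pullbacks by $\phi_\sigma^{-1}$ of the $k$th order cubical $p$-forms. For a continuous $p$-form $\omega$ on $\Omega$, the interpolant $\mathcal W\mathcal C_k\omega$ is the form, given on each $n$-cell $\sigma$ by an element of $Q_k^p(\sigma)$, such that $$\int_\upsilon \mathcal W\mathcal C_k\omega=\int_\upsilon\omega\qquad\text{for all $k$th order small $p$-cubes $\upsilon$ of all $n$-cells $\sigma$ of $K$.}$$ Let $\Theta(\sigma)=|\sigma|/\operatorname{diam}(\sigma)^n$ denote the fullness of an $n$-cell $\sigma$, and let $|\cdot|$ be the comass norm of $p$-covectors. **Theorem.** Let $\omega$ be a $p$-form that is smooth on an open set containing $\Omega$ and whose derivatives of order $k$ are bounded on $\Omega$ (which is automatic if $\Omega$ is compact). There is a constant $C_{\omega,k}$ such that, whenever $h>0$, $C_\Theta>0$, and $K$ is a cubical mesh in $\Omega$ with $\operatorname{diam}(\sigma)\le h$ and $\Theta(\sigma)\ge C_\Theta$ for all $n$-cells $\sigma$ of $K$, the interpolant $\mathcal W\mathcal C_k\omega$ exists, is unique, and satisfies $$|\mathcal W\mathcal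 C_k\omega(x)-\omega(x)|\le\frac{C_{\omega,k}}{C_\Theta^{\,p}}\,h^k\qquad\text{for all $x\in\sigma$ and all $n$-cells $\sigma$ of $K$.}$$ -/

import Mathlib

open MeasureTheory Set

/-- Differential `p`-forms on `ℝⁿ` (Euclidean). The norm on the values is the comass norm
`sup {|α (v₁, …, v_p)| : |v_i| ≤ 1}`. -/
abbrev DForm (n p : ℕ) : Type :=
  EuclideanSpace ℝ (Fin n) → (EuclideanSpace ℝ (Fin n)) [⋀^Fin p]→L[ℝ] ℝ

namespace CubicalForms

variable {n p : ℕ}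

/-- The pullback `f^* ω`. -/
noncomputable def pullback (f : EuclideanSpace ℝ (Fin n) → EuclideanSpace ℝ (Fin n))
    (ω : DForm n p) : DForm n p :=
  fun x => (ω (f x)).compContinuousLinearMap (fderiv ℝ f x)

/-- The integral of a `p`-form over the singular `p`-cube `γ : [0,1]^p → ℝⁿ`, which carries the
orientation given by the order of the `p` parameters. -/
noncomputable def integralOver (γ : (Fin p → ℝ) → EuclideanSpace ℝ (Fin n))
    (ω : DForm n p) : ℝ :=
  ∫ t in Icc (0 : Fin p → ℝ) 1, ω (γ t) (fun j => fderiv ℝ γ t (Pi.single j 1))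

/-- The determinant of `p` vectors of `ℝ^p`, as a continuous alternating map. -/
noncomputable def detForm (p : ℕ) : (Fin p → ℝ) [⋀^Fin p]→L[ℝ] ℝ :=
  { (Matrix.detRowAlternating : (Fin p → ℝ) [⋀^Fin p]→ₗ[ℝ] ℝ) with
    cont := by
      change Continuous fun v : Fin p → Fin p → ℝ => Matrix.det (Matrix.of v)
      exact Continuous.matrix_det continuous_id }

/-- The constant form `dx_{i₁} ∧ ⋯ ∧ dx_{i_p}`, where `I j = i_j`; its value at `(v₁, …, v_p)` is
`det (v_a)_{i_b}`. -/
noncomputable def dx (I : Fin p ↪o Fin n) : (EuclideanSpace ℝ (Fin n)) [⋀^Fin p]→L[ℝ] ℝ :=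
  (detForm p).compContinuousLinearMap
    (ContinuousLinearMap.pi fun j => EuclideanSpace.proj (I j))

/-- The unit cube `□ⁿ = [0,1]ⁿ`. -/
def unitCube (n : ℕ) : Set (EuclideanSpace ℝ (Fin n)) := {x | ∀ i, x i ∈ Icc (0 : ℝ) 1}

/-- A `p`-face of `□ⁿ`: the coordinates `dir 0 < ⋯ < dir (p - 1)` run through `[0,1]` on the face,
and every other coordinate `i` has the constant value `val i ∈ {0, 1}`. (The value of `val` on the
free coordinates is normalised to `0`, so that a face has only one description.) -/
structure Face (n p : ℕ) where
  dir : Fin p ↪o Fin n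
  val : Fin n → Fin 2
  val_dir : ∀ j, val (dir j) = 0

/-- The set of points of a face. -/
def Face.carrier (τ : Face n p) : Set (EuclideanSpace ℝ (Fin n)) :=
  {x ∈ unitCube n | ∀ i ∉ Set.range τ.dir, x i = ((τ.val i : ℕ) : ℝ)}

/-- The standard parametrisation `[0,1]^p → τ`: the coordinate `dir j` is `t j` and the remaining
coordinates are `val`. -/
noncomputable def Face.param (τ : Face n p) (t : Fin p → ℝ) : EuclideanSpace ℝ (Fin n) :=
  WithLp.toLp 2 fun i => ((τ.val i : ℕ) : ℝ) + ∑ j, if τ.dir j = i then t j else 0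

/-- The map `x ↦ (m + x) / k` of `□ⁿ` into itself, for a multi-index `m` with `0 ≤ m_i ≤ k - 1`. -/
noncomputable def smallMap (k : ℕ) (m : Fin n → Fin k) (x : EuclideanSpace ℝ (Fin n)) :
    EuclideanSpace ℝ (Fin n) :=
  WithLp.toLp 2 fun i => (((m i : ℕ) : ℝ) + x i) / (k : ℝ)

/-- The lowest order cubical form of a face `τ` of `□ⁿ`,
`(∏_{i not free} x_i ^ y_i (1 - x_i) ^ (1 - y_i)) dx_{i₁} ∧ ⋯ ∧ dx_{i_p}` with `y = τ.val`. -/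
noncomputable def lowestForm (τ : Face n p) : DForm n p := fun x =>
  (∏ i ∈ (Finset.univ.image τ.dir)ᶜ,
    x i ^ (τ.val i : ℕ) * (1 - x i) ^ (1 - (τ.val i : ℕ))) • dx τ.dir

/-- The `k`th order cubical form of the small cube of `□ⁿ` given by `m` and `τ`. -/
noncomputable def cubicalForm (k : ℕ) (m : Fin n → Fin k) (τ : Face n p) : DForm n p := fun x =>
  (∏ i, x i ^ (m i : ℕ) * (1 - x i) ^ (k - 1 - (m i : ℕ))) • lowestForm τ x

/-- The oriented `k`th order small `p`-cube of `σ = φ(□ⁿ)` given by `m` and `τ`: it is the set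
`φ(smallMap k m (τ))`, parametrised through `τ`. -/
noncomputable def smallCube (φ : EuclideanSpace ℝ (Fin n) ≃ᵃ[ℝ] EuclideanSpace ℝ (Fin n)) (k : ℕ)
    (m : Fin n → Fin k) (τ : Face n p) : (Fin p → ℝ) → EuclideanSpace ℝ (Fin n) :=
  fun t => φ (smallMap k m (τ.param t))

/-- The space of `k`th order cubical `p`-forms of the parallelotope `φ(□ⁿ)`: the span of the
pullbacks through `φ⁻¹` of the `k`th order cubical forms of `□ⁿ`. -/
noncomputable def cellSpace (φ : EuclideanSpace ℝ (Fin n) ≃ᵃ[ℝ] EuclideanSpace ℝ (Fin n))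
    (k p : ℕ) : Submodule ℝ (DForm n p) :=
  Submodule.span ℝ
    {η | ∃ (m : Fin n → Fin k) (τ : Face n p), η = pullback φ.symm (cubicalForm k m τ)}

/-- A cubical mesh in `Ω ⊆ ℝⁿ`, given by its `n`-cells: each of them is a parallelotope contained in
`Ω`, the image of `□ⁿ` under an affine bijection, and two of them that meet do so in a common face
(of some dimension). The other cells of the mesh are the faces of the `n`-cells. -/
structure CubicalMesh (n : ℕ) (Ω : Set (EuclideanSpace ℝ (Fin n))) where
  cells : Set (Set (EuclideanSpace ℝ (Fin n)))
  chart : cells → (EuclideanSpace ℝ (Fin n) ≃ᵃ[ℝ] EuclideanSpace ℝ (Fin n))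
  chart_image : ∀ σ : cells, chart σ '' unitCube n = σ
  subset : ∀ σ : cells, (σ : Set (EuclideanSpace ℝ (Fin n))) ⊆ Ω
  inter : ∀ σ σ' : cells, ((σ : Set (EuclideanSpace ℝ (Fin n))) ∩ σ').Nonempty →
    ∃ (q : ℕ) (τ τ' : Face n q),
      (σ : Set (EuclideanSpace ℝ (Fin n))) ∩ σ' = chart σ '' τ.carrier ∧
      (σ : Set (EuclideanSpace ℝ (Fin n))) ∩ σ' = chart σ' '' τ'.carrier

/-- The fullness `|σ| / diam(σ)ⁿ` of an `n`-cell. -/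
noncomputable def fullness (σ : Set (EuclideanSpace ℝ (Fin n))) : ℝ :=
  (volume σ).toReal / Metric.diam σ ^ n

variable {Ω : Set (EuclideanSpace ℝ (Fin n))}

/-- The oriented `p`-cells of the refinement `K_k`: the `k`th order small `p`-cubes of the
`n`-cells of `K`. -/
def CubicalMesh.smallCubes (K : CubicalMesh n Ω) (k p : ℕ) :
    Set ((Fin p → ℝ) → EuclideanSpace ℝ (Fin n)) :=
  {γ | ∃ (σ : K.cells) (m : Fin n → Fin k) (τ : Face n p), γ = smallCube (K.chart σ) k m τ}

/-- The de Rham map `𝒞_k` of the refinement `K_k`. -/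
noncomputable def CubicalMesh.deRham (K : CubicalMesh n Ω) (k : ℕ) (ω : DForm n p) :
    K.smallCubes k p → ℝ :=
  fun γ => integralOver γ.1 ω

/-- `η`, a form on each `n`-cell, interpolates the cochain `X`: on each `n`-cell `σ` it is a `k`th
order cubical form, and its integral over each small `p`-cube of `σ` is the value of `X` there. -/
def CubicalMesh.IsInterpolant (K : CubicalMesh n Ω) (k : ℕ) (X : K.smallCubes k p → ℝ)
    (η : K.cells → DForm n p) : Prop :=
  ∀ σ : K.cells, η σ ∈ cellSpace (K.chart σ) k p ∧
    ∀ (m : Fin n → Fin k) (τ : Face n p),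
      integralOver (smallCube (K.chart σ) k m τ) (η σ) =
        X ⟨smallCube (K.chart σ) k m τ, σ, m, τ, rfl⟩

/-- The interpolation operator `𝒲`: the form that interpolates `X` (some arbitrary form if there is
none; `K.interpolate k X σ` is the restriction to the `n`-cell `σ`). -/
noncomputable def CubicalMesh.interpolate (K : CubicalMesh n Ω) (k : ℕ)
    (X : K.smallCubes k p → ℝ) : K.cells → DForm n p :=
  Classical.epsilon (K.IsInterpolant k X)

end CubicalForms

/-! Everything is done on one cell at a time, pulled back to `unitCube n` by its chart. Evaluated on
the edge vectors (`frame`), a form becomes a tuple of scalar coefficients, one for each direction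
`I`. For cubical forms these are exactly the polynomials of degree at most `k - 1` in each free
coordinate and at most `k` in each other one (`coeffSpace`), and the integral over a small cube is
`k⁻ᵖ` times the mean of one coefficient (`integralOver_smallCube`). So the directions decouple into
scalar problems.

Each scalar problem has a dual basis of tensor products (`exists_dual`), which gives existence,
uniqueness (`eq_of_cubeMean_eq`) and a sup-norm bound on the reference cube
(`exists_stable_interpolation`).

For the error at a point `x`, compare with the Taylor polynomial of degree `k - 1` centred at `x`:
it lies in every `coeffSpace` and agrees with `ω` at `x`. Each coefficient of the error is then at
most a constant times `M * h ^ k * d ^ p`, with `d` the diameter of the cell. Returning to the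
comass norm costs `‖A⁻¹‖ ^ p`, `A` being the linear part of the chart, and Cramer's rule gives `d *
‖A⁻¹‖ ≤ c / CΘ`, so the powers of `d` cancel. -/

namespace CubicalForms

variable {n p : ℕ}

/-! ### Taylor's formula along a segment -/

section Taylor

variable {E F : Type*} [NormedAddCommGroup E] [NormedSpace ℝ E] [NormedAddCommGroup F]
  [NormedSpace ℝ F]

theorem iteratedDerivWithin_line {f : E → F} {U : Set E} (hU : IsOpen U) {k : ℕ}
    (hf : ContDiffOn ℝ k f U) {x v : E} (hseg : ∀ t ∈ Icc (0 : ℝ) 1, x + t • v ∈ U) :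
    ∀ j ≤ k, ∀ t ∈ Icc (0 : ℝ) 1,
      iteratedDerivWithin j (fun s : ℝ => f (x + s • v)) (Icc 0 1) t =
        iteratedFDeriv ℝ j f (x + t • v) fun _ => v := by
  intro j
  induction j with
  | zero => intro _ t _; simp
  | succ j ih =>
    intro hj t ht
    have hd : DifferentiableAt ℝ (iteratedFDeriv ℝ j f) (x + t • v) :=
      ((hf.contDiffAt (hU.mem_nhds (hseg t ht))).differentiableAt_iteratedFDeriv
        (by exact_mod_cast hj))
    have hline : HasDerivAt (fun s : ℝ => x + s • v) v t := by
      simpa using ((hasDerivAt_id t).smul_const v).const_add x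
    have h1 := hd.hasFDerivAt.comp_hasDerivAt t hline
    have h2 : HasDerivAt (fun s : ℝ => iteratedFDeriv ℝ j f (x + s • v) fun _ => v)
        (fderiv ℝ (iteratedFDeriv ℝ j f) (x + t • v) v fun _ => v) t :=
      ((ContinuousMultilinearMap.apply ℝ (fun _ : Fin j => E) F
        fun _ => v).hasFDerivAt.comp_hasDerivAt t h1)
    rw [iteratedDerivWithin_succ, derivWithin_congr (fun s hs => ih (by omega) s hs)
      (ih (by omega) t ht), h2.hasDerivWithinAt.derivWithin (uniqueDiffOn_Icc_zero_one t ht),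
      iteratedFDeriv_succ_apply_left]
    rfl

/-- The Taylor polynomial of degree `k` at `x`, as a function of the displacement. -/
noncomputable def taylorSum (f : E → F) (k : ℕ) (x v : E) : F :=
  ∑ j ∈ Finset.range (k + 1), ((j.factorial : ℝ)⁻¹) • iteratedFDeriv ℝ j f x fun _ => v

/-- One-variable Taylor for `s ↦ f (x + s • v)` between `0` and `1`; the factor `1 / k!` of the
remainder is discarded. -/
theorem norm_sub_taylorSum_le {f : E → F} {U : Set E} (hU : IsOpen U) {k : ℕ}
    (hf : ContDiffOn ℝ (k + 1 : ℕ) f U) {x v : E} {M : ℝ}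
    (hseg : ∀ t ∈ Icc (0 : ℝ) 1, x + t • v ∈ U)
    (hM : ∀ t ∈ Icc (0 : ℝ) 1, ‖iteratedFDeriv ℝ (k + 1) f (x + t • v)‖ ≤ M) :
    ‖f (x + v) - taylorSum f k x v‖ ≤ M * ‖v‖ ^ (k + 1) := by
  have hM0 : 0 ≤ M := (norm_nonneg _).trans (hM 0 (by simp))
  have hline : ContDiffOn ℝ (k + 1 : ℕ) (fun s : ℝ => f (x + s • v)) (Icc 0 1) :=
    hf.comp (ContDiff.contDiffOn (by fun_prop)) hseg
  have key := taylor_mean_remainder_bound (f := fun s : ℝ => f (x + s • v)) (n := k)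
    (x := 1) (C := M * ‖v‖ ^ (k + 1)) zero_le_one (by exact_mod_cast hline) (by simp) (by
      intro t ht
      rw [iteratedDerivWithin_line hU hf hseg _ le_rfl t ht]
      refine (ContinuousMultilinearMap.le_opNorm _ _).trans ?_
      simpa using mul_le_mul_of_nonneg_right (hM t ht) (by positivity))
  have ht : taylorWithinEval (fun s : ℝ => f (x + s • v)) k (Icc 0 1) 0 1 =
      taylorSum f k x v := by
    rw [taylor_within_apply, taylorSum]
    refine Finset.sum_congr rfl fun j hj => ?_
    rw [iteratedDerivWithin_line hU hf hseg j (by have := Finset.mem_range.1 hj; omega) 0 (by simp)]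
    simp
  rw [ht] at key
  simp only [one_smul, sub_zero, one_pow, mul_one] at key
  refine key.trans (div_le_self (by positivity) ?_)
  exact_mod_cast Nat.one_le_iff_ne_zero.2 (Nat.factorial_ne_zero k)

end Taylor

/-! ### Geometry of a parallelotope: edges, volume, fullness -/

/-- The standard basis vectors of Euclidean space. -/
noncomputable abbrev stdVec (i : Fin n) : EuclideanSpace ℝ (Fin n) := EuclideanSpace.single i 1

theorem sum_smul_stdVec (x : EuclideanSpace ℝ (Fin n)) : ∑ i, x i • stdVec i = x := by
  ext j
  simp [stdVec, Finset.sum_apply, Pi.single_apply]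

theorem convex_unitCube : Convex ℝ (unitCube n) := by
  intro x hx y hy a b ha hb hab i
  have := (convex_Icc (0 : ℝ) 1) (hx i) (hy i) ha hb hab
  simpa using this

theorem isCompact_unitCube : IsCompact (unitCube n) := by
  have h : unitCube n = WithLp.toLp 2 '' (Set.pi univ fun _ : Fin n => Icc (0 : ℝ) 1) := by
    ext x
    constructor
    · intro hx
      exact ⟨x.ofLp, fun i _ => hx i, rfl⟩
    · rintro ⟨y, hy, rfl⟩ i
      exact hy i trivial
  rw [h]
  exact (isCompact_univ_pi fun _ => isCompact_Icc).image (PiLp.continuous_toLp 2 _)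

/-- The linear part of an affine bijection, as a continuous linear equivalence. -/
noncomputable def linearPart
    (φ : EuclideanSpace ℝ (Fin n) ≃ᵃ[ℝ] EuclideanSpace ℝ (Fin n)) :
    EuclideanSpace ℝ (Fin n) ≃L[ℝ] EuclideanSpace ℝ (Fin n) :=
  φ.linear.toContinuousLinearEquiv

variable (φ : EuclideanSpace ℝ (Fin n) ≃ᵃ[ℝ] EuclideanSpace ℝ (Fin n))

theorem map_add_linearPart (x v : EuclideanSpace ℝ (Fin n)) :
    φ (x + v) = φ x + linearPart φ v := by
  have := φ.map_vadd x v
  simpa [linearPart, add_comm] using this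

theorem map_eq_linearPart_add (x : EuclideanSpace ℝ (Fin n)) :
    φ x = linearPart φ x + φ 0 := by
  simpa [add_comm] using map_add_linearPart φ 0 x

theorem isCompact_image_unitCube : IsCompact (φ '' unitCube n) := by
  refine isCompact_unitCube.image ?_
  rw [show (φ : EuclideanSpace ℝ (Fin n) → _) = fun x => linearPart φ x + φ 0 from
    funext (map_eq_linearPart_add φ)]
  fun_prop

theorem norm_linearPart_stdVec_le (i : Fin n) :
    ‖linearPart φ (stdVec i)‖ ≤ Metric.diam (φ '' unitCube n) := by
  have h := Metric.dist_le_diam_of_mem (isCompact_image_unitCube φ).isBounded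
    (mem_image_of_mem φ (show stdVec i ∈ unitCube n from fun j => by
      by_cases h : j = i <;> simp [PiLp.single_apply, h]))
    (mem_image_of_mem φ (show (0 : EuclideanSpace ℝ (Fin n)) ∈ unitCube n from fun j => by simp))
  rwa [map_eq_linearPart_add φ (stdVec i), dist_eq_norm, add_sub_cancel_right] at h

theorem volume_image_unitCube :
    (volume (φ '' unitCube n)).toReal =
      |LinearMap.det (linearPart φ : EuclideanSpace ℝ (Fin n) →ₗ[ℝ] EuclideanSpace ℝ (Fin n))| *
        (volume (unitCube n)).toReal := by
  have h : φ '' unitCube n = (fun y => y + φ 0) '' ((linearPart φ :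
      EuclideanSpace ℝ (Fin n) →ₗ[ℝ] EuclideanSpace ℝ (Fin n)) '' unitCube n) := by
    rw [image_image]
    exact image_congr fun x _ => map_eq_linearPart_add φ x
  rw [h, image_add_right, measure_preimage_add_right, Measure.addHaar_image_linearMap,
    ENNReal.toReal_mul, ENNReal.toReal_ofReal (abs_nonneg _)]

/-- Cramer's rule turns a lower bound for the volume of a parallelotope into an upper bound for the
inverse of the linear map that defines it. -/
theorem exists_norm_linearPart_symm_le (n : ℕ) : ∃ c : ℝ, 0 ≤ c ∧
    ∀ (φ : EuclideanSpace ℝ (Fin n) ≃ᵃ[ℝ] EuclideanSpace ℝ (Fin n)) (θ : ℝ), 0 < θ →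
      θ ≤ fullness (φ '' unitCube n) →
        Metric.diam (φ '' unitCube n) *
          ‖((linearPart φ).symm : EuclideanSpace ℝ (Fin n) →L[ℝ] EuclideanSpace ℝ (Fin n))‖ ≤
            c / θ := by
  let b := (EuclideanSpace.basisFun (Fin n) ℝ).toBasis
  have hb : ∀ i, b i = stdVec i := fun i => by simp [b]
  have hcont : Continuous b.det.toMultilinearMap := by
    change Continuous fun v : Fin n → EuclideanSpace ℝ (Fin n) => b.det v
    simp_rw [Module.Basis.det_apply]
    refine Continuous.matrix_det (continuous_pi fun i => continuous_pi fun j => ?_)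
    change Continuous fun v : Fin n → EuclideanSpace ℝ (Fin n) => v j i
    fun_prop
  obtain ⟨D, hD0, hD⟩ := b.det.toMultilinearMap.exists_bound_of_continuous hcont
  set v := (volume (unitCube n)).toReal
  have hv0 : 0 ≤ v := ENNReal.toReal_nonneg
  -- `D` bounds the determinant as a multilinear map, `v` is the volume of the unit cube, and `n`
  -- comes from summing over coordinates.
  refine ⟨n * (D * v), by positivity, fun φ θ hθ hfull => ?_⟩
  set d := Metric.diam (φ '' unitCube n) with hd
  have hd0 : 0 ≤ d := Metric.diam_nonneg
  set A := linearPart φ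
  set δ := LinearMap.det (A : EuclideanSpace ℝ (Fin n) →ₗ[ℝ] EuclideanSpace ℝ (Fin n))
  -- If `d ^ n` were zero, the fullness would be `0` by the convention for division, against `0 <
  -- θ`.
  have hdn : 0 < d ^ n := by
    refine lt_of_le_of_ne (by positivity) fun h => ?_
    rw [fullness, ← hd, ← h, div_zero] at hfull
    linarith
  have hvol : θ * d ^ n ≤ |δ| * v := by
    rw [fullness, ← hd, le_div_iff₀ hdn, volume_image_unitCube] at hfull
    exact hfull
  have hcoord : ∀ (w : EuclideanSpace ℝ (Fin n)) (i : Fin n),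
      d * |A.symm w i| ≤ D * v / θ * ‖w‖ := by
    intro w i
    set x := A.symm w
    have hw : w = ∑ j, x j • A (stdVec j) := by
      rw [← A.apply_symm_apply w]
      conv_lhs => rw [← sum_smul_stdVec (A.symm w)]
      simp [x]
    have hcr : b.det (Function.update (fun j => A (stdVec j)) i w) = x i * δ := by
      have h1 : b.det (fun j => A (stdVec j)) = δ := by
        have := b.det_comp (A : EuclideanSpace ℝ (Fin n) →ₗ[ℝ] EuclideanSpace ℝ (Fin n)) b
        rw [b.det_self, mul_one] at this
        refine Eq.trans ?_ this
        congr 1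
        ext1 j
        simp [hb]
      rw [hw, AlternatingMap.map_update_sum, Finset.sum_eq_single i]
      · rw [AlternatingMap.map_update_smul, Function.update_eq_self, h1, smul_eq_mul]
      · intro j _ hj
        rw [AlternatingMap.map_update_smul, AlternatingMap.map_update_self _ _ hj.symm, smul_zero]
      · simp
    -- One column is `w` and the other `n - 1` are edges of length at most `d`; the extra `d`
    -- completes the `d ^ n` of the fullness.
    have hbd : |x i| * |δ| * d ≤ D * (‖w‖ * d ^ n) := by
      rw [← abs_mul, ← hcr]
      have h2 := hD (Function.update (fun j => A (stdVec j)) i w)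
      have h3 : ∏ j, ‖Function.update (fun j => A (stdVec j)) i w j‖ ≤ ‖w‖ * d ^ (n - 1) := by
        rw [← Finset.mul_prod_erase _ _ (Finset.mem_univ i), Function.update_self]
        refine mul_le_mul_of_nonneg_left ?_ (norm_nonneg _)
        refine (Finset.prod_le_prod (g := fun _ => d) (fun _ _ => norm_nonneg _)
          fun j hj => ?_).trans (by simp)
        rw [Function.update_of_ne (Finset.ne_of_mem_erase hj)]
        exact norm_linearPart_stdVec_le φ j
      have h4 : d ^ n = d ^ (n - 1) * d := by
        rw [← pow_succ]; congr 1; have := i.pos; omega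
      rw [h4, ← mul_assoc, ← mul_assoc, mul_assoc D]
      exact mul_le_mul_of_nonneg_right (h2.trans (mul_le_mul_of_nonneg_left h3 hD0.le)) hd0
    rw [div_mul_eq_mul_div, le_div_iff₀ hθ]
    refine le_of_mul_le_mul_right ?_ hdn
    calc d * |x i| * θ * d ^ n = d * |x i| * (θ * d ^ n) := by ring
      _ ≤ d * |x i| * (|δ| * v) := by gcongr
      _ = (|x i| * |δ| * d) * v := by ring
      _ ≤ D * (‖w‖ * d ^ n) * v := by gcongr
      _ = D * v * ‖w‖ * d ^ n := by ring
  -- By `hdn`, `d = 0` can happen only for `n = 0`.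
  rcases hd0.eq_or_lt with h0 | hpos
  · rw [← h0, zero_mul]; positivity
  rw [mul_comm, ← le_div_iff₀ hpos]
  refine ContinuousLinearMap.opNorm_le_bound _ (by positivity) fun w => ?_
  change ‖A.symm w‖ ≤ _
  rw [div_mul_eq_mul_div, le_div_iff₀ hpos]
  calc ‖A.symm w‖ * d ≤ (∑ i, |A.symm w i|) * d := by
        gcongr
        conv_lhs => rw [← sum_smul_stdVec (A.symm w)]
        refine (norm_sum_le _ _).trans (Finset.sum_le_sum fun i _ => ?_)
        simp [norm_smul]
    _ = ∑ i, d * |A.symm w i| := by rw [mul_comm, Finset.mul_sum]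
    _ ≤ ∑ _i : Fin n, D * v / θ * ‖w‖ := Finset.sum_le_sum fun i _ => hcoord w i
    _ = n * (D * v) / θ * ‖w‖ := by simp; ring

/-! ### The polynomial space of the coefficients -/

/-- The degree in the coordinate `i` of the coefficients of `dx I` in the `k`th order cubical
forms. -/
def coeffDegree (k : ℕ) (I : Fin p ↪o Fin n) (i : Fin n) : ℕ :=
  open Classical in if i ∈ Set.range I then k - 1 else k

/-- The exponents of the `k`th order cubical forms with direction `I`; they also index the
`k`th order small cubes with direction `I`. -/
def grid (k : ℕ) (I : Fin p ↪o Fin n) : Finset (Fin n → ℕ) :=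
  Fintype.piFinset fun i => Finset.range (coeffDegree k I i + 1)

theorem mem_grid {k : ℕ} {I : Fin p ↪o Fin n} {a : Fin n → ℕ} :
    a ∈ grid k I ↔ ∀ i, a i ≤ coeffDegree k I i := by
  simp [grid]

/-- The coefficient of a `k`th order cubical form. -/
noncomputable def bern (k : ℕ) (I : Fin p ↪o Fin n) (a : Fin n → ℕ)
    (x : EuclideanSpace ℝ (Fin n)) : ℝ :=
  ∏ i, x i ^ a i * (1 - x i) ^ (coeffDegree k I i - a i)

/-- The span of the coefficients of the `k`th order cubical forms with direction `I`. -/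
noncomputable def coeffSpace (k : ℕ) (I : Fin p ↪o Fin n) :
    Submodule ℝ (EuclideanSpace ℝ (Fin n) → ℝ) :=
  Submodule.span ℝ (bern k I '' grid k I)

/-- The parametrisation of a small cube of `□ⁿ`. -/
noncomputable def gridCube (k : ℕ) (I : Fin p ↪o Fin n) (a : Fin n → ℕ) (t : Fin p → ℝ) :
    EuclideanSpace ℝ (Fin n) :=
  WithLp.toLp 2 fun i => ((a i : ℝ) + ∑ j, if I j = i then t j else 0) / k

/-- The mean of a function on a small cube of `□ⁿ`. -/
noncomputable def cubeMean (k : ℕ) (I : Fin p ↪o Fin n) (a : Fin n → ℕ)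
    (f : EuclideanSpace ℝ (Fin n) → ℝ) : ℝ :=
  ∫ t in Icc (0 : Fin p → ℝ) 1, f (gridCube k I a t)

section Bernstein

/-- Multiply `x ^ j` by `(x + (1 - x)) ^ (d - j) = 1` and expand. -/
theorem pow_mem_span_bernstein {j d : ℕ} (hj : j ≤ d) : ∃ c : ℕ → ℝ, ∀ x : ℝ,
    x ^ j = ∑ a ∈ Finset.range (d + 1), c a * (x ^ a * (1 - x) ^ (d - a)) := by
  refine ⟨fun a => if j ≤ a then ((d - j).choose (a - j) : ℝ) else 0, fun x => ?_⟩
  have h1 : x ^ j = x ^ j * (x + (1 - x)) ^ (d - j) := by simp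
  rw [h1, add_pow, Finset.mul_sum]
  simp only [ite_mul, zero_mul]
  rw [← Finset.sum_filter]
  refine Finset.sum_bij' (fun a _ => a + j) (fun a _ => a - j) ?_ ?_ ?_ ?_ ?_
  · intro a ha
    simp only [Finset.mem_range, Finset.mem_filter] at ha ⊢
    omega
  · intro a ha
    simp only [Finset.mem_range, Finset.mem_filter] at ha ⊢
    omega
  · intro a _; simp
  · intro a ha
    simp only [Finset.mem_range, Finset.mem_filter] at ha
    omega
  · intro a ha
    rw [show d - j - a = d - (a + j) by omega, Nat.add_sub_cancel, pow_add]
    ring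

theorem eval_mem_span_bernstein (Q : Polynomial ℝ) {d : ℕ} (hQ : Q.natDegree ≤ d) :
    ∃ c : ℕ → ℝ, ∀ x : ℝ,
      Q.eval x = ∑ a ∈ Finset.range (d + 1), c a * (x ^ a * (1 - x) ^ (d - a)) := by
  have h : ∀ j, ∃ c : ℕ → ℝ, j ≤ d → ∀ x : ℝ,
      x ^ j = ∑ a ∈ Finset.range (d + 1), c a * (x ^ a * (1 - x) ^ (d - a)) := fun j => by
    by_cases hj : j ≤ d
    · obtain ⟨c, hc⟩ := pow_mem_span_bernstein hj
      exact ⟨c, fun _ => hc⟩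
    · exact ⟨0, fun h => absurd h hj⟩
  choose c hc using h
  refine ⟨fun a => ∑ j ∈ Finset.range (d + 1), Q.coeff j * c j a, fun x => ?_⟩
  rw [Q.eval_eq_sum_range' (Nat.lt_succ_of_le hQ)]
  simp_rw [Finset.sum_mul]
  rw [Finset.sum_comm]
  refine Finset.sum_congr rfl fun j hj => ?_
  rw [hc j (Nat.lt_succ_iff.1 (Finset.mem_range.1 hj)) x, Finset.mul_sum]
  exact Finset.sum_congr rfl fun a _ => by ring

end Bernstein

theorem prod_eval_mem_coeffSpace {k : ℕ} {I : Fin p ↪o Fin n} (Q : Fin n → Polynomial ℝ)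
    (hQ : ∀ i, (Q i).natDegree ≤ coeffDegree k I i) :
    (fun x : EuclideanSpace ℝ (Fin n) => ∏ i, (Q i).eval (x i)) ∈ coeffSpace k I := by
  choose c hc using fun i => eval_mem_span_bernstein (Q i) (hQ i)
  have h : (fun x : EuclideanSpace ℝ (Fin n) => ∏ i, (Q i).eval (x i)) =
      ∑ a ∈ grid k I, (∏ i, c i (a i)) • bern k I a := by
    ext x
    simp_rw [hc, Finset.prod_univ_sum]
    simp [Finset.sum_apply, bern, grid, Finset.prod_mul_distrib]
  rw [h]
  exact Submodule.sum_mem _ fun a ha => Submodule.smul_mem _ _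
    (Submodule.subset_span (mem_image_of_mem _ ha))

/-- Group the factors by coordinate: no exponent exceeds `j ≤ k - 1`, the smaller of the two
permitted degrees. Hence polynomials of total degree at most `k - 1` belong to the space for every
`I`. -/
theorem prod_sub_mem_coeffSpace {k : ℕ} {I : Fin p ↪o Fin n} {j : ℕ} (hj : j ≤ k - 1)
    (r : Fin j → Fin n) (c : EuclideanSpace ℝ (Fin n)) :
    (fun x : EuclideanSpace ℝ (Fin n) => ∏ l, (x (r l) - c (r l))) ∈ coeffSpace k I := by
  classical
  have := prod_eval_mem_coeffSpace (k := k) (I := I)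
    (fun i => (Polynomial.X - Polynomial.C (c i)) ^ (Finset.univ.filter fun l => r l = i).card)
    (fun i => by
      refine (Polynomial.natDegree_pow_le_of_le _ (Polynomial.natDegree_X_sub_C_le _)).trans ?_
      have h1 := Finset.card_le_univ (Finset.univ.filter fun l => r l = i)
      rw [Fintype.card_fin] at h1
      unfold coeffDegree
      split_ifs <;> omega)
  convert this using 2 with x
  rw [← Finset.prod_fiberwise (s := Finset.univ) (g := r)]
  refine Finset.prod_congr rfl fun i _ => ?_
  rw [Finset.prod_congr rfl (g := fun _ => x i - c i)
    (fun l hl => by rw [(Finset.mem_filter.1 hl).2])]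
  simp

theorem continuous_of_mem_coeffSpace {k : ℕ} {I : Fin p ↪o Fin n}
    {f : EuclideanSpace ℝ (Fin n) → ℝ} (hf : f ∈ coeffSpace k I) : Continuous f := by
  induction hf using Submodule.span_induction with
  | mem f hf =>
    obtain ⟨a, -, rfl⟩ := hf
    unfold bern
    fun_prop
  | zero => exact continuous_zero
  | add f g _ _ hf hg => exact hf.add hg
  | smul c f _ hf => exact hf.const_smul c

theorem continuous_gridCube (k : ℕ) (I : Fin p ↪o Fin n) (a : Fin n → ℕ) :
    Continuous (gridCube k I a) := by
  refine (PiLp.continuous_toLp 2 _).comp (continuous_pi fun i => ?_)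
  refine (continuous_const.add (continuous_finsetSum _ fun j _ => ?_)).div_const _
  split_ifs <;> fun_prop

theorem sum_ite_range_mem_Icc (I : Fin p ↪o Fin n) {t : Fin p → ℝ} (ht : t ∈ Icc 0 1) (i : Fin n) :
    0 ≤ (∑ j, if I j = i then t j else 0) ∧
      (∑ j, if I j = i then t j else 0) ≤ if i ∈ Set.range I then 1 else 0 := by
  classical
  by_cases hi : i ∈ Set.range I
  · obtain ⟨j, rfl⟩ := hi
    simpa using ⟨ht.1 j, ht.2 j⟩
  · have : ∀ j, I j ≠ i := fun j hj => hi ⟨j, hj⟩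
    simp [this]

theorem gridCube_mem_unitCube {k : ℕ} (hk : 1 ≤ k) {I : Fin p ↪o Fin n} {a : Fin n → ℕ}
    (ha : a ∈ grid k I) {t : Fin p → ℝ} (ht : t ∈ Icc 0 1) : gridCube k I a t ∈ unitCube n := by
  classical
  intro i
  have h0 := sum_ite_range_mem_Icc I ht i
  have h1 := mem_grid.1 ha i
  have hk' : (0 : ℝ) < k := by exact_mod_cast hk
  refine ⟨div_nonneg (add_nonneg (Nat.cast_nonneg _) h0.1) hk'.le, (div_le_one hk').2 ?_⟩
  refine (add_le_add_right h0.2 _).trans ?_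
  unfold coeffDegree at h1
  split_ifs at h1 ⊢ with h
  · have : a i + 1 ≤ k := by omega
    exact_mod_cast this
  · simpa using h1

theorem integrableOn_comp_gridCube {k : ℕ} (hk : 1 ≤ k) {I : Fin p ↪o Fin n} {a : Fin n → ℕ}
    (ha : a ∈ grid k I) {f : EuclideanSpace ℝ (Fin n) → ℝ} (hf : ContinuousOn f (unitCube n)) :
    IntegrableOn (fun t => f (gridCube k I a t)) (Icc (0 : Fin p → ℝ) 1) :=
  (hf.comp (continuous_gridCube k I a).continuousOn
    fun _ ht => gridCube_mem_unitCube hk ha ht).integrableOn_compact isCompact_Icc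

/-! ### Dual functions for the means on small cubes -/

section Dual

theorem exists_lagrange {k : ℕ} (hk : 1 ≤ k) (y : ℕ → ℝ) : ∃ P : Polynomial ℝ, P.natDegree ≤ k ∧
    ∀ j ≤ k, P.eval ((j : ℝ) / k) = y j := by
  have hk' : (k : ℝ) ≠ 0 := by positivity
  have hinj : Set.InjOn (fun j : ℕ => (j : ℝ) / k) (Finset.range (k + 1)) := by
    intro i _ j _ h
    simpa [div_left_inj' hk'] using h
  refine ⟨Lagrange.interpolate (Finset.range (k + 1)) (fun j : ℕ => (j : ℝ) / k) y, ?_, ?_⟩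
  · refine Polynomial.natDegree_le_of_degree_le ((Lagrange.degree_interpolate_le y hinj).trans ?_)
    simp
  · intro j hj
    exact Lagrange.eval_interpolate_at_node y hinj (Finset.mem_range.2 (by omega))

/-- Differentiate the interpolant of a step of height `1 / k` between the nodes `m / k` and `(m + 1)
/ k`: the mean over the `j`th subinterval is `k` times the increment between its endpoints. -/
theorem exists_mean_dual {k : ℕ} (hk : 1 ≤ k) (m : ℕ) : ∃ P : Polynomial ℝ,
    P.natDegree ≤ k - 1 ∧ ∀ j ≤ k - 1,
      ∫ t in Icc (0 : ℝ) 1, P.eval (((j : ℝ) + t) / k) = if j = m then 1 else 0 := by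
  have hk' : (k : ℝ) ≠ 0 := by positivity
  obtain ⟨P, hP, hPj⟩ := exists_lagrange hk fun j => if m < j then (k : ℝ)⁻¹ else 0
  refine ⟨P.derivative, (Polynomial.natDegree_derivative_le P).trans (by omega), fun j hj => ?_⟩
  rw [integral_Icc_eq_integral_Ioc, ← intervalIntegral.integral_of_le zero_le_one]
  have hder : ∀ t ∈ uIcc (0 : ℝ) 1, HasDerivAt (fun t : ℝ => k * P.eval (((j : ℝ) + t) / k))
      (P.derivative.eval (((j : ℝ) + t) / k)) t := by
    intro t _
    have h1 : HasDerivAt (fun t : ℝ => ((j : ℝ) + t) / k) (1 / k) t :=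
      ((hasDerivAt_id t).const_add _).div_const _
    have h2 := ((P.hasDerivAt (((j : ℝ) + t) / k)).comp t h1).const_mul (k : ℝ)
    exact h2.congr_deriv (by field_simp)
  rw [intervalIntegral.integral_eq_sub_of_hasDerivAt hder
    (Continuous.intervalIntegrable (by fun_prop) _ _)]
  have h1 := hPj (j + 1) (by omega)
  have h0 := hPj j (by omega)
  push_cast at h1
  rw [add_zero, h1, h0]
  rcases lt_trichotomy j m with h | h | h
  · rw [if_neg (by omega), if_neg (by omega), if_neg (by omega)]; ring
  · rw [if_pos (by omega), if_neg (by omega), if_pos h]; field_simp; ring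
  · rw [if_pos (by omega), if_pos (by omega), if_neg (by omega)]; ring

end Dual

theorem prod_eq_prod_range_mul (I : Fin p ↪o Fin n) (f : Fin n → ℝ) :
    ∏ i, f i = (∏ j, f (I j)) * ∏ i ∈ (Finset.univ.image I)ᶜ, f i := by
  classical
  rw [← Finset.prod_mul_prod_compl (Finset.univ.image I), Finset.prod_image I.injective.injOn]

theorem gridCube_apply_dir (k : ℕ) (I : Fin p ↪o Fin n) (a : Fin n → ℕ) (t : Fin p → ℝ)
    (j : Fin p) : gridCube k I a t (I j) = ((a (I j) : ℝ) + t j) / k := by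
  simp [gridCube]

theorem gridCube_apply_of_notMem (k : ℕ) (I : Fin p ↪o Fin n) (a : Fin n → ℕ) (t : Fin p → ℝ)
    {i : Fin n} (hi : i ∉ Set.range I) : gridCube k I a t i = (a i : ℝ) / k := by
  have : ∀ j, I j ≠ i := fun j hj => hi ⟨j, hj⟩
  simp [gridCube, this]

/-- Fubini: a free coordinate contributes a mean, a fixed one a point value at a node. -/
theorem cubeMean_prod (k : ℕ) (I : Fin p ↪o Fin n) (a : Fin n → ℕ) (u : Fin n → ℝ → ℝ) :
    cubeMean k I a (fun x => ∏ i, u i (x i)) =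
      (∏ j, ∫ t in Icc (0 : ℝ) 1, u (I j) (((a (I j) : ℝ) + t) / k)) *
        ∏ i ∈ (Finset.univ.image I)ᶜ, u i ((a i : ℝ) / k) := by
  have h : ∀ t, ∏ i, u i (gridCube k I a t i) =
      (∏ j, u (I j) (((a (I j) : ℝ) + t j) / k)) *
        ∏ i ∈ (Finset.univ.image I)ᶜ, u i ((a i : ℝ) / k) := fun t => by
    rw [prod_eq_prod_range_mul I]
    simp_rw [gridCube_apply_dir]
    congr 1
    refine Finset.prod_congr rfl fun i hi => ?_
    rw [gridCube_apply_of_notMem _ _ _ _ (by simpa using hi)]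
  unfold cubeMean
  simp_rw [h]
  rw [integral_mul_const, ← pi_univ_Icc, volume_pi, Measure.restrict_pi_pi]
  congr 1
  exact integral_fintype_prod_eq_prod
    (fun (j : Fin p) (t : ℝ) => u (I j) (((a (I j) : ℝ) + t) / k))

/-- Tensor product of one-variable duals: `exists_mean_dual` in the free coordinates, Lagrange
polynomials in the others. -/
theorem exists_dual {k : ℕ} (hk : 1 ≤ k) (I : Fin p ↪o Fin n) (a : Fin n → ℕ) :
    ∃ u ∈ coeffSpace k I, ∀ b ∈ grid k I, cubeMean k I b u = if b = a then 1 else 0 := by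
  classical
  choose P hP hPj using fun m => exists_mean_dual hk m
  choose R hR hRj using fun m : ℕ => exists_lagrange hk fun j => if j = m then 1 else 0
  set Q : Fin n → Polynomial ℝ := fun i => if i ∈ Set.range I then P (a i) else R (a i) with hQ
  refine ⟨_, prod_eval_mem_coeffSpace Q fun i => ?_, fun b hb => ?_⟩
  · simp only [hQ, coeffDegree]
    split_ifs
    · exact hP _
    · exact hR _
  rw [cubeMean_prod k I b fun i x => (Q i).eval x]
  have hb' := mem_grid.1 hb
  have h1 : ∀ j, (∫ t in Icc (0 : ℝ) 1, (Q (I j)).eval (((b (I j) : ℝ) + t) / k)) =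
      if b (I j) = a (I j) then 1 else 0 := fun j => by
    simp only [hQ, Set.mem_range_self, if_true]
    refine hPj _ _ ?_
    simpa [coeffDegree] using hb' (I j)
  have h2 : ∏ i ∈ (Finset.univ.image I)ᶜ, (Q i).eval ((b i : ℝ) / k) =
      ∏ i ∈ (Finset.univ.image I)ᶜ, if b i = a i then 1 else 0 :=
    Finset.prod_congr rfl fun i hi => by
      have hi' : i ∉ Set.range I := by simpa using hi
      simp only [hQ, hi', if_false]
      refine hRj _ _ ?_
      simpa only [coeffDegree, hi', if_false] using hb' i
  simp_rw [h1, h2]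
  rw [← prod_eq_prod_range_mul I fun i => if b i = a i then 1 else 0, Finset.prod_ite_zero]
  simp [funext_iff]

theorem cubeMean_add {k : ℕ} (hk : 1 ≤ k) {I : Fin p ↪o Fin n} {a : Fin n → ℕ}
    (ha : a ∈ grid k I) {f g : EuclideanSpace ℝ (Fin n) → ℝ} (hf : ContinuousOn f (unitCube n))
    (hg : ContinuousOn g (unitCube n)) :
    cubeMean k I a (f + g) = cubeMean k I a f + cubeMean k I a g :=
  integral_add (integrableOn_comp_gridCube hk ha hf) (integrableOn_comp_gridCube hk ha hg)

theorem cubeMean_smul (k : ℕ) (I : Fin p ↪o Fin n) (a : Fin n → ℕ) (c : ℝ)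
    (f : EuclideanSpace ℝ (Fin n) → ℝ) : cubeMean k I a (c • f) = c * cubeMean k I a f :=
  integral_const_mul c _

theorem cubeMean_sub {k : ℕ} (hk : 1 ≤ k) {I : Fin p ↪o Fin n} {a : Fin n → ℕ}
    (ha : a ∈ grid k I) {f g : EuclideanSpace ℝ (Fin n) → ℝ} (hf : ContinuousOn f (unitCube n))
    (hg : ContinuousOn g (unitCube n)) :
    cubeMean k I a (f - g) = cubeMean k I a f - cubeMean k I a g :=
  integral_sub (integrableOn_comp_gridCube hk ha hf) (integrableOn_comp_gridCube hk ha hg)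

theorem abs_cubeMean_le {k : ℕ} (hk : 1 ≤ k) {I : Fin p ↪o Fin n} {a : Fin n → ℕ}
    (ha : a ∈ grid k I) {f : EuclideanSpace ℝ (Fin n) → ℝ} {B : ℝ}
    (hf : ∀ x ∈ unitCube n, |f x| ≤ B) : |cubeMean k I a f| ≤ B := by
  have h := norm_setIntegral_le_of_norm_le_const (μ := volume) (s := Icc (0 : Fin p → ℝ) 1)
    (f := fun t => f (gridCube k I a t)) (C := B)
    (by rw [Real.volume_Icc_pi]; simp) fun t ht => hf _ (gridCube_mem_unitCube hk ha ht)
  simpa [cubeMean, Measure.real, Real.volume_Icc_pi] using h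

/-! ### Unisolvence and stability on the reference cube -/

/-- The means on the small cubes, as a linear map on the cubical coefficients. -/
noncomputable def cubeMeans {k : ℕ} (hk : 1 ≤ k) (I : Fin p ↪o Fin n) :
    coeffSpace k I →ₗ[ℝ] (grid k I → ℝ) where
  toFun f a := cubeMean k I a f
  map_add' f g := by
    ext a
    exact cubeMean_add hk a.2 (continuous_of_mem_coeffSpace f.2).continuousOn
      (continuous_of_mem_coeffSpace g.2).continuousOn
  map_smul' c f := by
    ext a
    exact cubeMean_smul k I a c f

/-- The dual functions give surjectivity, and the space is spanned by at most as many functions as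
there are grid indices; a dimension count does the rest. -/
theorem injective_cubeMeans {k : ℕ} (hk : 1 ≤ k) (I : Fin p ↪o Fin n) :
    Function.Injective (cubeMeans hk I) := by
  classical
  have hsurj : Function.Surjective (cubeMeans hk I) := by
    choose u hu hub using exists_dual hk I
    intro y
    refine ⟨∑ a : grid k I, y a • ⟨u a, hu a⟩, ?_⟩
    rw [map_sum]
    ext b
    rw [Finset.sum_apply, Finset.sum_eq_single b]
    · simp [cubeMeans, cubeMean_smul, hub b b b.2]
    · intro a _ hab
      have : (b : Fin n → ℕ) ≠ a := fun h => hab (Subtype.ext h.symm)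
      simp [cubeMeans, cubeMean_smul, hub a b b.2, this]
    · simp
  have hfin : FiniteDimensional ℝ (coeffSpace k I) :=
    FiniteDimensional.span_of_finite ℝ ((grid k I).finite_toSet.image _)
  have hle : Module.finrank ℝ (coeffSpace k I) ≤ (grid k I).card := by
    have h := finrank_span_finset_le_card (R := ℝ) ((grid k I).image (bern k I))
    rw [Finset.coe_image] at h
    exact h.trans Finset.card_image_le
  have hge := LinearMap.finrank_le_finrank_of_surjective hsurj
  rw [Module.finrank_fintype_fun_eq_card, Fintype.card_coe] at hge
  refine (LinearMap.injective_iff_surjective_of_finrank_eq_finrank ?_).2 hsurj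
  rw [Module.finrank_fintype_fun_eq_card, Fintype.card_coe]
  exact le_antisymm hle hge

theorem eq_of_cubeMean_eq {k : ℕ} (hk : 1 ≤ k) {I : Fin p ↪o Fin n}
    {f g : EuclideanSpace ℝ (Fin n) → ℝ} (hf : f ∈ coeffSpace k I) (hg : g ∈ coeffSpace k I)
    (h : ∀ a ∈ grid k I, cubeMean k I a f = cubeMean k I a g) : f = g :=
  congrArg Subtype.val (injective_cubeMeans hk I (a₁ := ⟨f, hf⟩) (a₂ := ⟨g, hg⟩)
    (funext fun a => h a a.2))

/-- The interpolant is the sum of the dual functions weighted by the means of `f`, so `Λ` is a sum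
of bounds for the dual functions on the cube. -/
theorem exists_stable_interpolation {k : ℕ} (hk : 1 ≤ k) (I : Fin p ↪o Fin n) :
    ∃ Λ : ℝ, 0 ≤ Λ ∧ ∀ f : EuclideanSpace ℝ (Fin n) → ℝ,
      ∃ g ∈ coeffSpace k I, (∀ a ∈ grid k I, cubeMean k I a g = cubeMean k I a f) ∧
        ∀ B, (∀ x ∈ unitCube n, |f x| ≤ B) → ∀ x ∈ unitCube n, |g x| ≤ Λ * B := by
  classical
  choose u hu hub using exists_dual hk I
  have hbd : ∀ a, ∃ C : ℝ, ∀ x ∈ unitCube n, ‖u a x‖ ≤ C := fun a =>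
    isCompact_unitCube.exists_bound_of_continuousOn
      (continuous_of_mem_coeffSpace (hu a)).continuousOn
  choose C hC using hbd
  have hC0 : ∀ a, 0 ≤ C a := fun a =>
    (norm_nonneg _).trans (hC a 0 fun i => by simp)
  have hmem : ∀ f : EuclideanSpace ℝ (Fin n) → ℝ,
      ∑ a ∈ grid k I, cubeMean k I a f • u a ∈ coeffSpace k I := fun f =>
    Submodule.sum_mem _ fun a _ => Submodule.smul_mem _ _ (hu a)
  refine ⟨∑ a ∈ grid k I, C a, Finset.sum_nonneg fun a _ => hC0 a,
    fun f => ⟨_, hmem f, fun b hb => ?_, fun B hB x hx => ?_⟩⟩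
  · have h : cubeMeans hk I ⟨_, hmem f⟩ =
        ∑ a ∈ grid k I, cubeMean k I a f • cubeMeans hk I ⟨u a, hu a⟩ := by
      simp_rw [← map_smul, ← map_sum]
      congr 1
      ext1
      simp
    have h' := congrFun h ⟨b, hb⟩
    refine h'.trans ?_
    rw [Finset.sum_apply, Finset.sum_eq_single b]
    · simp [cubeMeans, hub b b hb]
    · intro a _ hab
      simp [cubeMeans, hub a b hb, hab.symm]
    · exact fun h => absurd hb h
  · rw [Finset.sum_apply, Finset.sum_mul]
    refine (Finset.abs_sum_le_sum_abs _ _).trans (Finset.sum_le_sum fun a ha => ?_)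
    rw [Pi.smul_apply, smul_eq_mul, abs_mul, mul_comm]
    exact mul_le_mul (hC a x hx) (abs_cubeMean_le hk ha hB) (abs_nonneg _) (hC0 a)

/-- Interpolation reproduces cubical coefficients, and it is stable: it is quasi-optimal. -/
theorem exists_quasioptimal {k : ℕ} (hk : 1 ≤ k) (I : Fin p ↪o Fin n) :
    ∃ Λ : ℝ, 0 ≤ Λ ∧ ∀ f : EuclideanSpace ℝ (Fin n) → ℝ, ContinuousOn f (unitCube n) →
      ∀ g ∈ coeffSpace k I, (∀ a ∈ grid k I, cubeMean k I a g = cubeMean k I a f) →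
        ∀ T ∈ coeffSpace k I, ∀ B, (∀ x ∈ unitCube n, |f x - T x| ≤ B) →
          ∀ x ∈ unitCube n, |g x - T x| ≤ Λ * B := by
  obtain ⟨Λ, hΛ, h⟩ := exists_stable_interpolation hk I
  refine ⟨Λ, hΛ, fun f hf g hg hgf T hT B hB x hx => ?_⟩
  -- By uniqueness, `g - T` is the interpolant of `f - T`, so stability applies to it.
  obtain ⟨g', hg', hgf', hb⟩ := h (f - T)
  have hTc := (continuous_of_mem_coeffSpace hT).continuousOn (s := unitCube n)
  have hgc := (continuous_of_mem_coeffSpace hg).continuousOn (s := unitCube n)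
  have heq : g - T = g' := eq_of_cubeMean_eq hk (Submodule.sub_mem _ hg hT) hg' fun a ha => by
    rw [hgf' a ha, cubeMean_sub hk ha hgc hTc, cubeMean_sub hk ha hf hTc, hgf a ha]
  have := hb B hB x hx
  rwa [← heq] at this

/-! ### Alternating forms in the frame of edge vectors -/

section Alternating

/-- Sorting an injective tuple of indices changes both sides by the same sign. -/
theorem eq_of_apply_basis_eq (b : Module.Basis (Fin n) ℝ (EuclideanSpace ℝ (Fin n)))
    {α β : (EuclideanSpace ℝ (Fin n)) [⋀^Fin p]→L[ℝ] ℝ}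
    (h : ∀ I : Fin p ↪o Fin n, α (fun j => b (I j)) = β fun j => b (I j)) : α = β := by
  refine ContinuousAlternatingMap.toAlternatingMap_injective (b.ext_alternating fun v hv => ?_)
  have hs : StrictMono (v ∘ Tuple.sort v) :=
    (Tuple.monotone_sort v).strictMono_of_injective (hv.comp (Tuple.sort v).injective)
  have key := h (OrderEmbedding.ofStrictMono _ hs)
  have hα := α.toAlternatingMap.map_perm (fun j => b (v j)) (Tuple.sort v)
  have hβ := β.toAlternatingMap.map_perm (fun j => b (v j)) (Tuple.sort v)
  have := hα.symm.trans (key.trans hβ)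
  exact MulAction.injective _ this

/-- An increasing map is determined by its range, so for `I ≠ J` some `I j` lies outside the range
of `J` and gives a zero row. -/
theorem dx_apply_stdVec (I J : Fin p ↪o Fin n) :
    dx J (fun j => stdVec (I j)) = if I = J then 1 else 0 := by
  change Matrix.det (Matrix.of fun a b => (stdVec (I a) : EuclideanSpace ℝ (Fin n)) (J b)) = _
  split_ifs with h
  · subst h
    refine Eq.trans (congrArg Matrix.det ?_) Matrix.det_one
    ext a b
    by_cases hab : a = b <;> simp [Matrix.one_apply, hab, eq_comm]
  · have hex : ∃ j, I j ∉ Set.range J := by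
      by_contra! hcon
      have hsub : Finset.univ.map I.toEmbedding ⊆ Finset.univ.map J.toEmbedding := by
        intro i hi
        simp only [Finset.mem_map, Finset.mem_univ, true_and] at hi ⊢
        obtain ⟨j, rfl⟩ := hi
        exact hcon j
      have heq := Finset.eq_of_subset_of_card_le hsub (by simp)
      have hr : Set.range I = Set.range J := by
        have := congrArg (fun s : Finset (Fin n) => (s : Set (Fin n))) heq
        simpa using this
      exact h (DFunLike.coe_injective ((I.strictMono.range_inj J.strictMono).1 hr))
    obtain ⟨j, hj⟩ := hex
    refine Matrix.det_eq_zero_of_row_eq_zero j fun b => ?_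
    have : J b ≠ I j := fun hb => hj ⟨b, hb⟩
    simp [this]

end Alternating

variable (φ : EuclideanSpace ℝ (Fin n) ≃ᵃ[ℝ] EuclideanSpace ℝ (Fin n))

/-- The edge vectors of a parallelotope in the directions `I`. -/
noncomputable def frame (I : Fin p ↪o Fin n) (j : Fin p) : EuclideanSpace ℝ (Fin n) :=
  linearPart φ (stdVec (I j))

/-- The coefficient of `dx I` in the pullback of `η` to `□ⁿ`. -/
noncomputable def cellCoeff (I : Fin p ↪o Fin n) (η : DForm n p) (x : EuclideanSpace ℝ (Fin n)) :
    ℝ :=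
  η (φ x) (frame φ I)

/-- The form `dx I` of `□ⁿ`, carried to a parallelotope. -/
noncomputable def cellDx (I : Fin p ↪o Fin n) : (EuclideanSpace ℝ (Fin n)) [⋀^Fin p]→L[ℝ] ℝ :=
  (dx I).compContinuousLinearMap (linearPart φ).symm

theorem cellDx_apply_frame (I J : Fin p ↪o Fin n) :
    cellDx φ J (frame φ I) = if I = J then 1 else 0 := by
  rw [← dx_apply_stdVec]
  simp [cellDx, frame, Function.comp_def]

theorem eq_of_apply_frame_eq {α β : (EuclideanSpace ℝ (Fin n)) [⋀^Fin p]→L[ℝ] ℝ}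
    (h : ∀ I : Fin p ↪o Fin n, α (frame φ I) = β (frame φ I)) : α = β := by
  refine eq_of_apply_basis_eq ((EuclideanSpace.basisFun (Fin n) ℝ).toBasis.map
    (linearPart φ).toLinearEquiv) fun I => ?_
  have hb : ∀ i, ((EuclideanSpace.basisFun (Fin n) ℝ).toBasis.map (linearPart φ).toLinearEquiv) i =
      linearPart φ (stdVec i) := fun i => by simp
  simp_rw [hb]
  exact h I

theorem sum_apply_frame_smul_cellDx (α : (EuclideanSpace ℝ (Fin n)) [⋀^Fin p]→L[ℝ] ℝ) :
    ∑ I : Fin p ↪o Fin n, α (frame φ I) • cellDx φ I = α := by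
  refine eq_of_apply_frame_eq φ fun J => ?_
  rw [ContinuousAlternatingMap.sum_apply, Finset.sum_eq_single J]
  · simp [cellDx_apply_frame]
  · intro I _ hI
    simp [cellDx_apply_frame, hI.symm]
  · simp

theorem norm_le_sum_apply_frame (α : (EuclideanSpace ℝ (Fin n)) [⋀^Fin p]→L[ℝ] ℝ) :
    ‖α‖ ≤ ∑ I : Fin p ↪o Fin n, |α (frame φ I)| * (‖dx I‖ *
      ‖((linearPart φ).symm : EuclideanSpace ℝ (Fin n) →L[ℝ] EuclideanSpace ℝ (Fin n))‖ ^ p) := by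
  conv_lhs => rw [← sum_apply_frame_smul_cellDx φ α]
  refine (norm_sum_le _ _).trans (Finset.sum_le_sum fun I _ => ?_)
  rw [norm_smul, Real.norm_eq_abs]
  refine mul_le_mul_of_nonneg_left ?_ (abs_nonneg _)
  simpa [cellDx] using ContinuousAlternatingMap.norm_compContinuousLinearMap_le (dx I)
    ((linearPart φ).symm : EuclideanSpace ℝ (Fin n) →L[ℝ] EuclideanSpace ℝ (Fin n))

theorem hasFDerivAt_affineEquiv (x : EuclideanSpace ℝ (Fin n)) :
    HasFDerivAt φ
      (linearPart φ : EuclideanSpace ℝ (Fin n) →L[ℝ] EuclideanSpace ℝ (Fin n)) x := by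
  have := (linearPart φ).hasFDerivAt (x := x) |>.add_const (φ 0)
  exact this.congr_of_eventuallyEq (Filter.Eventually.of_forall (map_eq_linearPart_add φ))

theorem fderiv_affineEquiv_symm (x : EuclideanSpace ℝ (Fin n)) :
    fderiv ℝ φ.symm x =
      ((linearPart φ).symm : EuclideanSpace ℝ (Fin n) →L[ℝ] EuclideanSpace ℝ (Fin n)) := by
  rw [(hasFDerivAt_affineEquiv φ.symm x).fderiv]
  rfl

/-- The form on a parallelotope whose pullback to `□ⁿ` is `f dx I`. -/
noncomputable def cellForm (I : Fin p ↪o Fin n) :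
    (EuclideanSpace ℝ (Fin n) → ℝ) →ₗ[ℝ] DForm n p where
  toFun f y := f (φ.symm y) • cellDx φ I
  map_add' f g := by
    ext1 y
    exact add_smul _ _ _
  map_smul' c f := by
    ext1 y
    exact mul_smul c (f (φ.symm y)) _

theorem cellCoeff_cellForm (I J : Fin p ↪o Fin n) (f : EuclideanSpace ℝ (Fin n) → ℝ) :
    cellCoeff φ I (cellForm φ J f) = if I = J then f else 0 := by
  ext x
  have : cellCoeff φ I (cellForm φ J f) x = f (φ.symm (φ x)) * cellDx φ J (frame φ I) := rfl
  rw [this, cellDx_apply_frame, φ.symm_apply_apply]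
  split_ifs <;> simp

/-! ### From cubical forms and integrals to coefficients and means -/

/-- The index in the grid of the small cube given by `m` and `τ`. -/
def gridIndex {k : ℕ} (m : Fin n → Fin k) (τ : Face n p) (i : Fin n) : ℕ := m i + τ.val i

theorem gridIndex_mem_grid {k : ℕ} (m : Fin n → Fin k) (τ : Face n p) :
    gridIndex m τ ∈ grid k τ.dir := by
  rw [mem_grid]
  intro i
  have h1 := (m i).isLt
  have h2 := (τ.val i).isLt
  unfold coeffDegree gridIndex
  split_ifs with h
  · obtain ⟨j, rfl⟩ := h
    simp only [τ.val_dir, Fin.val_zero]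
    omega
  · omega

/-- In a fixed coordinate, an index strictly between `0` and `k` arises twice, from `m i` with value
`0` and from `m i - 1` raised to the next node by value `1`. The first choice is taken, and `k - 1`
with value `1` at the end `k`. -/
theorem exists_gridIndex_eq {k : ℕ} (hk : 1 ≤ k) {I : Fin p ↪o Fin n} {a : Fin n → ℕ}
    (ha : a ∈ grid k I) : ∃ (m : Fin n → Fin k) (τ : Face n p), τ.dir = I ∧ gridIndex m τ = a := by
  rw [mem_grid] at ha
  refine ⟨fun i => ⟨min (a i) (k - 1), by omega⟩,
    ⟨I, fun i => if a i < k then 0 else 1, fun j => if_pos ?_⟩, rfl, funext fun i => ?_⟩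
  · have := ha (I j)
    simp only [coeffDegree, Set.mem_range_self, if_true] at this
    omega
  · have h1 : a i ≤ k := (ha i).trans (by unfold coeffDegree; split_ifs <;> omega)
    simp only [gridIndex]
    split_ifs
    · simp; omega
    · simp; omega

theorem smallMap_param {k : ℕ} (m : Fin n → Fin k) (τ : Face n p) (t : Fin p → ℝ) :
    smallMap k m (τ.param t) = gridCube k τ.dir (gridIndex m τ) t := by
  ext i
  simp [smallMap, Face.param, gridCube, gridIndex, add_assoc]

/-- Exponents add up, so `m` and `τ.val` enter only through their sum: different descriptions of one
small cube give the same form. -/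
theorem pullback_cubicalForm {k : ℕ} (m : Fin n → Fin k) (τ : Face n p) :
    pullback φ.symm (cubicalForm k m τ) =
      cellForm φ τ.dir (bern k τ.dir (gridIndex m τ)) := by
  ext1 y
  have h : ∀ x : EuclideanSpace ℝ (Fin n),
      (∏ i, x i ^ (m i : ℕ) * (1 - x i) ^ (k - 1 - (m i : ℕ))) *
        (∏ i ∈ (Finset.univ.image τ.dir)ᶜ,
          x i ^ (τ.val i : ℕ) * (1 - x i) ^ (1 - (τ.val i : ℕ))) =
      bern k τ.dir (gridIndex m τ) x := fun x => by
    unfold bern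
    rw [prod_eq_prod_range_mul τ.dir, prod_eq_prod_range_mul τ.dir
      (fun i => x i ^ gridIndex m τ i * _), mul_assoc, ← Finset.prod_mul_distrib]
    congr 1
    · refine Finset.prod_congr rfl fun j _ => ?_
      simp [gridIndex, τ.val_dir, coeffDegree]
    · refine Finset.prod_congr rfl fun i hi => ?_
      have hi' : i ∉ Set.range τ.dir := by simpa using hi
      have h1 := (m i).isLt
      have h2 := (τ.val i).isLt
      simp only [gridIndex, coeffDegree, hi', if_false]
      rw [show k - ((m i : ℕ) + (τ.val i : ℕ)) = (k - 1 - (m i : ℕ)) + (1 - (τ.val i : ℕ)) by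
        omega, pow_add, pow_add]
      ring
  unfold pullback cubicalForm lowestForm
  rw [fderiv_affineEquiv_symm, smul_smul, h]
  rfl

theorem cellForm_mem_cellSpace {k : ℕ} (hk : 1 ≤ k) {I : Fin p ↪o Fin n}
    {f : EuclideanSpace ℝ (Fin n) → ℝ} (hf : f ∈ coeffSpace k I) :
    cellForm φ I f ∈ cellSpace φ k p := by
  have hle : coeffSpace k I ≤ (cellSpace φ k p).comap (cellForm φ I) := by
    refine Submodule.span_le.2 ?_
    rintro _ ⟨a, ha, rfl⟩
    obtain ⟨m, τ, rfl, rfl⟩ := exists_gridIndex_eq hk ha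
    exact Submodule.subset_span ⟨m, τ, (pullback_cubicalForm φ m τ).symm⟩
  exact hle hf

theorem cellCoeff_mem_coeffSpace {k : ℕ} {η : DForm n p} (hη : η ∈ cellSpace φ k p)
    (I : Fin p ↪o Fin n) : cellCoeff φ I η ∈ coeffSpace k I := by
  induction hη using Submodule.span_induction with
  | mem η hη =>
    obtain ⟨m, τ, rfl⟩ := hη
    rw [pullback_cubicalForm, cellCoeff_cellForm]
    split_ifs with h
    · subst h
      exact Submodule.subset_span (mem_image_of_mem _ (gridIndex_mem_grid m τ))
    · exact Submodule.zero_mem _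
  | zero => exact Submodule.zero_mem (coeffSpace k I)
  | add η η' _ _ h h' => exact Submodule.add_mem _ h h'
  | smul c η _ h => exact Submodule.smul_mem _ c h

theorem eq_of_cellCoeff_eq {η η' : DForm n p}
    (h : ∀ I : Fin p ↪o Fin n, cellCoeff φ I η = cellCoeff φ I η') : η = η' := by
  ext1 y
  refine eq_of_apply_frame_eq φ fun I => ?_
  have := congrFun (h I) (φ.symm y)
  simpa [cellCoeff] using this

theorem hasFDerivAt_gridCube (k : ℕ) (I : Fin p ↪o Fin n) (a : Fin n → ℕ) (t : Fin p → ℝ) :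
    HasFDerivAt (gridCube k I a) (∑ j, (ContinuousLinearMap.proj (R := ℝ) (φ := fun _ => ℝ) j :
      (Fin p → ℝ) →L[ℝ] ℝ).smulRight ((k : ℝ)⁻¹ • (stdVec (I j) : EuclideanSpace ℝ (Fin n)))) t := by
  set L : (Fin p → ℝ) →L[ℝ] EuclideanSpace ℝ (Fin n) :=
    ∑ j, (ContinuousLinearMap.proj (R := ℝ) (φ := fun _ => ℝ) j :
      (Fin p → ℝ) →L[ℝ] ℝ).smulRight ((k : ℝ)⁻¹ • (stdVec (I j) : EuclideanSpace ℝ (Fin n)))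
  have h : ∀ s, gridCube k I a s = L s + gridCube k I a 0 := fun s => by
    ext i
    simp [gridCube, L, Finset.sum_apply, Pi.single_apply, div_eq_mul_inv, add_comm, add_mul,
      Finset.sum_mul, eq_comm]
  exact (L.hasFDerivAt.add_const _).congr_of_eventuallyEq (Filter.Eventually.of_forall h)

/-- The `p` tangent vectors are the edge vectors divided by `k`, and multilinearity extracts `k⁻ᵖ`.
-/
theorem integralOver_smallCube {k : ℕ} (m : Fin n → Fin k) (τ : Face n p) (η : DForm n p) :
    integralOver (smallCube φ k m τ) η =
      ((k : ℝ)⁻¹) ^ p * cubeMean k τ.dir (gridIndex m τ) (cellCoeff φ τ.dir η) := by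
  have h1 : smallCube φ k m τ = φ ∘ gridCube k τ.dir (gridIndex m τ) := by
    ext1 t
    simp [smallCube, smallMap_param]
  have h2 : ∀ t j, fderiv ℝ (smallCube φ k m τ) t (Pi.single j 1) =
      (k : ℝ)⁻¹ • frame φ τ.dir j := fun t j => by
    rw [h1, ((hasFDerivAt_affineEquiv φ _).comp t (hasFDerivAt_gridCube k _ _ t)).fderiv]
    simp [frame, Pi.single_apply]
  unfold integralOver cubeMean
  simp_rw [h2]
  rw [← integral_const_mul]
  congr 1
  ext1 t
  rw [h1]
  have h3 := (η (φ (gridCube k τ.dir (gridIndex m τ) t))).toMultilinearMap.map_smul_univ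
    (fun _ => (k : ℝ)⁻¹) (frame φ τ.dir)
  simpa [cellCoeff] using h3

theorem integralOver_smallCube_eq_iff {k : ℕ} (hk : 1 ≤ k) (η η' : DForm n p) :
    (∀ (m : Fin n → Fin k) (τ : Face n p),
      integralOver (smallCube φ k m τ) η = integralOver (smallCube φ k m τ) η') ↔
    ∀ I : Fin p ↪o Fin n, ∀ a ∈ grid k I,
      cubeMean k I a (cellCoeff φ I η) = cubeMean k I a (cellCoeff φ I η') := by
  have hk' : ((k : ℝ)⁻¹) ^ p ≠ 0 := by positivity
  simp_rw [integralOver_smallCube, mul_right_inj' hk']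
  constructor
  · intro h I a ha
    obtain ⟨m, τ, rfl, rfl⟩ := exists_gridIndex_eq hk ha
    exact h m τ
  · intro h m τ
    exact h _ _ (gridIndex_mem_grid m τ)

theorem existsUnique_cellInterpolant {k : ℕ} (hk : 1 ≤ k) (ω : DForm n p) :
    ∃! η : DForm n p, η ∈ cellSpace φ k p ∧ ∀ (m : Fin n → Fin k) (τ : Face n p),
      integralOver (smallCube φ k m τ) η = integralOver (smallCube φ k m τ) ω := by
  classical
  have hex := fun I : Fin p ↪o Fin n =>
    (exists_stable_interpolation hk I).choose_spec.2 (cellCoeff φ I ω)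
  choose g hg hgω _ using hex
  have hco : ∀ I, cellCoeff φ I (∑ J : Fin p ↪o Fin n, cellForm φ J (g J)) = g I := fun I => by
    have h : cellCoeff φ I (∑ J : Fin p ↪o Fin n, cellForm φ J (g J)) =
        ∑ J : Fin p ↪o Fin n, cellCoeff φ I (cellForm φ J (g J)) := by
      ext x
      simp [cellCoeff, Finset.sum_apply, ContinuousAlternatingMap.sum_apply]
    simp [h, cellCoeff_cellForm]
  refine ⟨∑ J : Fin p ↪o Fin n, cellForm φ J (g J), ⟨Submodule.sum_mem _ fun J _ =>
    cellForm_mem_cellSpace φ hk (hg J), ?_⟩, ?_⟩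
  · rw [integralOver_smallCube_eq_iff φ hk]
    intro I a ha
    rw [hco, hgω I a ha]
  · rintro η ⟨hη, hint⟩
    rw [integralOver_smallCube_eq_iff φ hk] at hint
    refine eq_of_cellCoeff_eq φ fun I => ?_
    rw [hco]
    refine eq_of_cubeMean_eq hk (cellCoeff_mem_coeffSpace φ hη I) (hg I) fun a ha => ?_
    rw [hint I a ha, hgω I a ha]

/-! ### The error estimate on one cell -/

theorem multilinear_mem_coeffSpace {k j : ℕ} (hj : j ≤ k - 1) (I : Fin p ↪o Fin n)
    (L : EuclideanSpace ℝ (Fin n) [×j]→L[ℝ] ((EuclideanSpace ℝ (Fin n)) [⋀^Fin p]→L[ℝ] ℝ))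
    (c : EuclideanSpace ℝ (Fin n)) (v : Fin p → EuclideanSpace ℝ (Fin n)) :
    (fun x => L (fun _ => linearPart φ (x - c)) v) ∈ coeffSpace k I := by
  have h : (fun x => L (fun _ => linearPart φ (x - c)) v) =
      ∑ r : Fin j → Fin n, L (fun l => linearPart φ (stdVec (r l))) v •
        fun x : EuclideanSpace ℝ (Fin n) => ∏ l, (x (r l) - c (r l)) := by
    ext x
    have h1 : linearPart φ (x - c) = ∑ i, (x i - c i) • linearPart φ (stdVec i) := by
      conv_lhs => rw [← sum_smul_stdVec (x - c)]
      simp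
    have h2 : ∀ r : Fin j → Fin n,
        L (fun l => (x (r l) - c (r l)) • linearPart φ (stdVec (r l))) =
          (∏ l, (x (r l) - c (r l))) • L fun l => linearPart φ (stdVec (r l)) := fun r =>
      L.toMultilinearMap.map_smul_univ (fun l => x (r l) - c (r l)) _
    rw [h1, L.map_sum, ContinuousAlternatingMap.sum_apply, Finset.sum_apply]
    refine Finset.sum_congr rfl fun r _ => ?_
    rw [h2]
    simp [mul_comm]
  rw [h]
  exact Submodule.sum_mem _ fun r _ => Submodule.smul_mem _ _ (prod_sub_mem_coeffSpace hj r c)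

/-- Degree `k` goes with order `k + 1`: the smaller degree bound of that order is `k`. -/
theorem taylorSum_mem_coeffSpace (k : ℕ) (I : Fin p ↪o Fin n) (ω : DForm n p)
    (y c : EuclideanSpace ℝ (Fin n)) (v : Fin p → EuclideanSpace ℝ (Fin n)) :
    (fun x => taylorSum ω k y (linearPart φ (x - c)) v) ∈ coeffSpace (k + 1) I := by
  have h : (fun x => taylorSum ω k y (linearPart φ (x - c)) v) =
      ∑ j ∈ Finset.range (k + 1), ((j.factorial : ℝ)⁻¹) •
        fun x => iteratedFDeriv ℝ j ω y (fun _ => linearPart φ (x - c)) v := by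
    ext x
    simp [taylorSum, Finset.sum_apply, ContinuousAlternatingMap.sum_apply]
  rw [h]
  refine Submodule.sum_mem _ fun j hj => Submodule.smul_mem _ _
    (multilinear_mem_coeffSpace φ ?_ I _ c v)
  have := Finset.mem_range.1 hj
  omega

theorem prod_norm_frame_le (I : Fin p ↪o Fin n) :
    ∏ j, ‖frame φ I j‖ ≤ Metric.diam (φ '' unitCube n) ^ p := by
  refine (Finset.prod_le_prod (g := fun _ => Metric.diam (φ '' unitCube n))
    (fun _ _ => norm_nonneg _) fun j _ => norm_linearPart_stdVec_le φ (I j)).trans (by simp)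

/-- The interpolation error on a single parallelotope. -/
theorem exists_cell_error_bound (n p : ℕ) {k : ℕ} (hk : 1 ≤ k) : ∃ C : ℝ, 0 ≤ C ∧
    ∀ (φ : EuclideanSpace ℝ (Fin n) ≃ᵃ[ℝ] EuclideanSpace ℝ (Fin n)) (θ h M : ℝ), 0 < θ →
      θ ≤ fullness (φ '' unitCube n) → Metric.diam (φ '' unitCube n) ≤ h →
      ∀ (U : Set (EuclideanSpace ℝ (Fin n))) (ω : DForm n p), IsOpen U →
        φ '' unitCube n ⊆ U → ContDiffOn ℝ k ω U →
        (∀ x ∈ φ '' unitCube n, ‖iteratedFDeriv ℝ k ω x‖ ≤ M) →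
        ∀ η ∈ cellSpace φ k p, (∀ (m : Fin n → Fin k) (τ : Face n p),
          integralOver (smallCube φ k m τ) η = integralOver (smallCube φ k m τ) ω) →
        ∀ x ∈ φ '' unitCube n, ‖η x - ω x‖ ≤ C * M / θ ^ p * h ^ k := by
  obtain ⟨k, rfl⟩ : ∃ l, k = l + 1 := ⟨k - 1, by omega⟩
  obtain ⟨c, hc0, hc⟩ := exists_norm_linearPart_symm_le n
  choose Λ hΛ0 hΛ using fun I : Fin p ↪o Fin n => exists_quasioptimal hk I
  refine ⟨(∑ I, Λ I * ‖dx I‖) * c ^ p, mul_nonneg (Finset.sum_nonneg fun I _ =>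
    mul_nonneg (hΛ0 I) (norm_nonneg _)) (by positivity), ?_⟩
  rintro φ θ h M hθ hfull hdiam U ω hU hσU hω hM η hη hint _ ⟨x, hx, rfl⟩
  rw [integralOver_smallCube_eq_iff φ hk] at hint
  set d := Metric.diam (φ '' unitCube n)
  set A := linearPart φ
  have hd0 : 0 ≤ d := Metric.diam_nonneg
  have hM0 : 0 ≤ M := (norm_nonneg _).trans (hM _ (mem_image_of_mem φ hx))
  have hseg : ∀ y ∈ unitCube n, ∀ t ∈ Icc (0 : ℝ) 1, φ x + t • A (y - x) ∈ φ '' unitCube n := by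
    intro y hy t ht
    refine ⟨x + t • (y - x), convex_unitCube.add_smul_sub_mem hx hy ht, ?_⟩
    rw [map_add_linearPart, map_smul]
  have hφ : ∀ y, φ y = φ x + A (y - x) := fun y => by
    rw [← map_add_linearPart, add_sub_cancel]
  have htaylor : ∀ y ∈ unitCube n,
      ‖ω (φ y) - taylorSum ω k (φ x) (A (y - x))‖ ≤ M * ‖A (y - x)‖ ^ (k + 1) := by
    intro y hy
    rw [hφ y]
    exact norm_sub_taylorSum_le hU hω (fun t ht => hσU (hseg y hy t ht))
      fun t ht => hM _ (hseg y hy t ht)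
  have hcont : ∀ I : Fin p ↪o Fin n, ContinuousOn (cellCoeff φ I ω) (unitCube n) := fun I => by
    have h1 : ContinuousOn (fun y => ω (φ y)) (unitCube n) :=
      hω.continuousOn.comp (fun y _ => (hasFDerivAt_affineEquiv φ y).continuousAt.continuousWithinAt)
        fun y hy => hσU (mem_image_of_mem φ hy)
    exact (ContinuousAlternatingMap.apply ℝ (EuclideanSpace ℝ (Fin n)) ℝ
      (frame φ I)).continuous.comp_continuousOn h1
  have hcoef : ∀ I : Fin p ↪o Fin n,
      |(η (φ x) - ω (φ x)) (frame φ I)| ≤ Λ I * (M * h ^ (k + 1) * d ^ p) := by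
    intro I
    -- The Taylor polynomial is centred at the point where the error is measured, so there it equals
    -- `ω` and bounding interpolant minus polynomial suffices.
    have hT : ω (φ x) (frame φ I) = taylorSum ω k (φ x) (A (x - x)) (frame φ I) := by
      have := htaylor x hx
      rw [sub_self, map_zero, norm_zero, zero_pow (Nat.succ_ne_zero k), mul_zero,
        norm_le_zero_iff, sub_eq_zero] at this
      rw [sub_self, map_zero, ← this]
    have key := hΛ I _ (hcont I) _ (cellCoeff_mem_coeffSpace φ hη I) (hint I) _
      (taylorSum_mem_coeffSpace φ k I ω (φ x) x (frame φ I)) (M * h ^ (k + 1) * d ^ p) (by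
        intro y hy
        have hdist : ‖A (y - x)‖ ≤ h := by
          have h1 := Metric.dist_le_diam_of_mem (isCompact_image_unitCube φ).isBounded
            (mem_image_of_mem φ hy) (mem_image_of_mem φ hx)
          rw [hφ y, dist_eq_norm, add_sub_cancel_left] at h1
          exact h1.trans hdiam
        have h2 := (ω (φ y) - taylorSum ω k (φ x) (A (y - x))).le_opNorm (frame φ I)
        refine h2.trans (mul_le_mul ((htaylor y hy).trans ?_) (prod_norm_frame_le φ I)
          (Finset.prod_nonneg fun _ _ => norm_nonneg _) (by
            have := hd0.trans hdiam; positivity))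
        gcongr) x hx
    rw [ContinuousAlternatingMap.sub_apply, hT]
    exact key
  refine (norm_le_sum_apply_frame φ _).trans ?_
  -- The `d ^ p` from the edge vectors is absorbed by the `p`th power of the norm of the inverse,
  -- leaving `c ^ p / θ ^ p`.
  have hAinv := pow_le_pow_left₀ (by positivity) (hc φ θ hθ hfull) p
  rw [mul_pow, div_pow] at hAinv
  have hh : 0 ≤ h := hd0.trans hdiam
  calc _ ≤ ∑ I : Fin p ↪o Fin n, Λ I * ‖dx I‖ * (M * h ^ (k + 1) * (c ^ p / θ ^ p)) := by
        refine Finset.sum_le_sum fun I _ => ?_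
        refine (mul_le_mul_of_nonneg_right (hcoef I) (by positivity)).trans ?_
        calc _ = Λ I * ‖dx I‖ * (M * h ^ (k + 1) * (d ^ p *
              ‖(A.symm : EuclideanSpace ℝ (Fin n) →L[ℝ] EuclideanSpace ℝ (Fin n))‖ ^ p)) := by ring
          _ ≤ _ := by
            have := hΛ0 I
            gcongr
    _ = _ := by rw [← Finset.sum_mul]; ring

end CubicalForms

theorem mainTheorem4 (n p k : ℕ) (hk : 1 ≤ k)
    (Ω U : Set (EuclideanSpace ℝ (Fin n))) (hU : IsOpen U) (hΩU : Ω ⊆ U)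
    (ω : DForm n p) (hω : ContDiffOn ℝ (⊤ : ℕ∞) ω U)
    (hbound : ∃ M : ℝ, ∀ x ∈ Ω, ‖iteratedFDeriv ℝ k ω x‖ ≤ M) :
    ∃ C : ℝ, ∀ (h CΘ : ℝ), 0 < h → 0 < CΘ → ∀ K : CubicalForms.CubicalMesh n Ω,
      (∀ σ ∈ K.cells, Metric.diam σ ≤ h ∧ CΘ ≤ CubicalForms.fullness σ) →
        (∃! η, K.IsInterpolant k (K.deRham k ω) η) ∧
        ∀ (σ : K.cells), ∀ x ∈ (σ : Set (EuclideanSpace ℝ (Fin n))),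
          ‖K.interpolate k (K.deRham k ω) σ x - ω x‖ ≤ C / CΘ ^ p * h ^ k := by
  obtain ⟨M, hM⟩ := hbound
  obtain ⟨C, -, hC⟩ := CubicalForms.exists_cell_error_bound n p hk
  refine ⟨C * M, fun h θ _ hθ K hK => ?_⟩
  -- Interpolation imposes no condition linking different cells, so the cellwise interpolants
  -- assemble freely.
  have hex : ∃! η, K.IsInterpolant k (K.deRham k ω) η := by
    choose η hη huniq using fun σ : K.cells =>
      CubicalForms.existsUnique_cellInterpolant (K.chart σ) hk ω
    exact ⟨η, hη, fun η' hη' => funext fun σ => huniq σ _ (hη' σ)⟩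
  refine ⟨hex, fun σ => ?_⟩
  have hI : K.IsInterpolant k (K.deRham k ω) (K.interpolate k (K.deRham k ω)) :=
    Classical.epsilon_spec hex.exists
  have hσ := K.chart_image σ
  have hKσ := hK σ σ.2
  have hsub := K.subset σ
  rw [← hσ] at hKσ hsub ⊢
  exact hC (K.chart σ) θ h M hθ hKσ.2 hKσ.1 U ω hU (hsub.trans hΩU)
    (hω.of_le (by exact_mod_cast le_top)) (fun x hx => hM x (hsub hx)) _ (hI σ).1 (hI σ).2
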